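/- Let $N\ge 1$, $d\ge 1$, and for $j,k\in\{1,\dots,N\}$ let $a_{jk}:[0,+\infty)\times(\mathbb{R}^d)^N\to[0,+\infty)$ be universally measurable, i.e. measurable with respect to the completion of every Borel probability measure. Let $\rho:[0,+\infty)\to[0,+\infty)$ be increasing (not necessarily strictly), absolutely continuous on compact intervals, with $\rho(t)\to+\infty$ as $t\to+\infty$. Assume that $a_{jk}(\rho(t),x)\,\rho'(t)$ is bounded, i.e. for all $j,k$ there is a constant $M$ with $a_{jk}(\rho(t),x)\,\rho'(t)\le M$ for a.e. $t\ge 0$ and every $x\in(\mathbb{R}^d)^N$. Put $$a^-_{jk}(t):=\inf_{x\in(\mathbb{R}^d)^N}a_{jk}(\rho(t),x)\,\rho'(t).$$ Suppose that the functions $a^-_{jk}$ are Lebesgue integrable on compact intervals and that there are a sequence $t_n\ge 0$ with $t_n\to+\infty$ and functions $a^*_{jk}:[0,+\infty)\to[0,+\infty)$, Lebesgue integrable on compact intervals, such that for all $j,k$ and all bounded intervals $[\alpha,\beta]\subset[0,+\infty)$ $$\lim_{n\to\infty}\int_\alpha^\beta a^-_{jk}(t_n+t)\,dt=\int_\alpha^\beta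 a^*_{jk}(t)\,dt ,$$ and that at least one of the following holds: (1) the directed graph on $\{1,\dots,N\}$ with an arrow $j\to k$ if and only if $\int_t^{+\infty}a^*_{jk}>0$ for all $t>0$ has a globally reachable node, i.e. a node $\ell^*$ such that from every node $i$ there is a (possibly trivial, if $i=\ell^*$) directed path to $\ell^*$; (2) for every pair $j\ne k$ at least one of $\int_0^{+\infty}a^*_{jk}>0$ and $\int_0^{+\infty}a^*_{kj}>0$ holds. Then every global trajectory $x=(x_1,\dots,x_N):[0,+\infty)\to(\mathbb{R}^d)^N$ of $$\dot x_j=\sum_{k=1}^N a_{jk}(t,x)\,(x_k-x_j),\qquad j=1,\dots,N,$$ (that is, $x$ is absolutely continuous on compact intervals and satisfies the system for a.e. $t\ge0$) converges to consensus: there is $x^*\in\mathbb{R}^d$ with $\lim_{t\to+\infty}x_j(t)=x^*$ for all $j$. -/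

import Mathlib

open MeasureTheory Set Filter
open scoped Topology NNReal

namespace Consensus

/-- A function is universally measurable if it is measurable with respect to the completion of
every Borel probability measure. -/
def UniversallyMeasurable {α β : Type*} [MeasurableSpace α] [MeasurableSpace β]
    (f : α → β) : Prop :=
  ∀ p : Measure α, IsProbabilityMeasure p → NullMeasurable f p

/-- `f` belongs to `L¹_loc([0,∞); [0,∞))`: it is nonnegative (almost everywhere) on `[0,∞)` and
Lebesgue integrable on every `[0,T]`. Values at negative times play no role. -/
def IsConnection (f : ℝ → ℝ) : Prop :=
  (∀ᵐ t ∂(volume.restrict (Ici (0 : ℝ))), 0 ≤ f t) ∧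
    ∀ T : ℝ, IntegrableOn f (Icc 0 T) volume

/-- `fₙ` converges to `g` if the integrals over every bounded interval `[a,b] ⊆ [0,∞)`
converge. -/
def ConvergesOnIntervals (f : ℕ → ℝ → ℝ) (g : ℝ → ℝ) : Prop :=
  ∀ a b : ℝ, 0 ≤ a → a ≤ b →
    Tendsto (fun n => ∫ t in a..b, f n t) atTop (𝓝 (∫ t in a..b, g t))

/-- `s` is a sequence of nonnegative times diverging to `+∞`, and for all `j, k` the translates
`t ↦ c_{jk}(sₙ + t)` converge to `c*_{jk}`; all `c_{jk}`, `c*_{jk}` are in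
`L¹_loc([0,∞); [0,∞))`. -/
structure IsLimitAlong {N : ℕ} (c : Fin N → Fin N → ℝ → ℝ) (s : ℕ → ℝ)
    (cstar : Fin N → Fin N → ℝ → ℝ) : Prop where
  connection : ∀ j k, IsConnection (c j k)
  connection_star : ∀ j k, IsConnection (cstar j k)
  nonneg : ∀ n, 0 ≤ s n
  tendsto_atTop : Tendsto s atTop atTop
  converges : ∀ j k, ConvergesOnIntervals (fun n t => c j k (s n + t)) (cstar j k)

/-- The digraph with an arrow `j → k` iff `∫_t^∞ c*_{jk} > 0` for all `t > 0`
(the integral may be `+∞`). -/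
def recurrentGraph {N : ℕ} (cstar : Fin N → Fin N → ℝ → ℝ) : Digraph (Fin N) where
  Adj j k := ∀ t : ℝ, 0 < t → 0 < ∫⁻ s in Ioi t, ENNReal.ofReal (cstar j k s)

/-- The digraph with an arrow `j → k` iff `∫_0^∞ c*_{jk} > 0` (the integral may be `+∞`). -/
def activeGraph {N : ℕ} (cstar : Fin N → Fin N → ℝ → ℝ) : Digraph (Fin N) where
  Adj j k := 0 < ∫⁻ s in Ioi (0 : ℝ), ENNReal.ofReal (cstar j k s)

/-- A node is globally reachable if every node has a path of arrows to it. -/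
def IsGloballyReachable {V : Type*} (G : Digraph V) (l : V) : Prop :=
  ∀ i, Relation.ReflTransGen G.Adj i l

/-- Along some sequence of times the translated connections have a limit whose recurrent graph
has a globally reachable node. -/
def ReachableCondition {N : ℕ} (c : Fin N → Fin N → ℝ → ℝ) : Prop :=
  ∃ (s : ℕ → ℝ) (cstar : Fin N → Fin N → ℝ → ℝ), IsLimitAlong c s cstar ∧
    ∃ l, IsGloballyReachable (recurrentGraph cstar) l

/-- Along some sequence of times the translated connections have a limit whose active graph has,
for each pair of distinct nodes, an arrow in at least one of the two directions. -/
def PairwiseCondition {N : ℕ} (c : Fin N → Fin N → ℝ → ℝ) : Prop :=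
  ∃ (s : ℕ → ℝ) (cstar : Fin N → Fin N → ℝ → ℝ), IsLimitAlong c s cstar ∧
    ∀ j k, j ≠ k → (activeGraph cstar).Adj j k ∨ (activeGraph cstar).Adj k j

/-- The state space of `N` agents in `ℝ^d`. -/
abbrev State (N d : ℕ) : Type := Fin N → EuclideanSpace ℝ (Fin d)

/-- The time-rescaled lower envelopes `t ↦ inf_x a_{jk}(ρ(t), x) ρ'(t)`. -/
noncomputable def rescaledEnvelope {N d : ℕ} (a : Fin N → Fin N → ℝ → State N d → ℝ)
    (ρ : ℝ → ℝ) (j k : Fin N) (t : ℝ) : ℝ :=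
  ⨅ x : State N d, a j k (ρ t) x * deriv ρ t

/-- `x` is a global Carathéodory solution on `[0,∞)` of
`x_j' = ∑_k a_{jk}(t, x) (x_k - x_j)`, `j = 1, …, N`. -/
def IsTrajectory {N d : ℕ} (a : Fin N → Fin N → ℝ → State N d → ℝ)
    (x : ℝ → State N d) : Prop :=
  (∀ T : ℝ, 0 ≤ T → ∀ j, AbsolutelyContinuousOnInterval (fun t => x t j) 0 T) ∧
    ∀ᵐ t ∂(volume.restrict (Ici (0 : ℝ))), ∀ j,
      HasDerivAt (fun s => x s j) (∑ k, a j k t (x t) • (x t k - x t j)) t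

/-- All agents converge to one common point. -/
def ConvergesToConsensus {N d : ℕ} (x : ℝ → State N d) : Prop :=
  ∃ xstar : EuclideanSpace ℝ (Fin d), ∀ j, Tendsto (fun t => x t j) atTop (𝓝 xstar)

end Consensus

namespace Consensus

/-! Along a fixed trajectory the coefficients are functions of time alone, so every coordinate
solves the same scalar linear system `u_j' = ∑ A_jk (u_k - u_j)`. Its bounds persist, and an agent
staying above a lower bound lifts whoever listens to it, with exponential losses. Rescaling time by
`ρ` bounds these losses over windows of fixed length and bounds the coefficient integrals below by
those of the envelopes. `Diffuses` records the outcome.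

On windows starting at `t_n` the envelope integrals approach those of `a*`, so the lifts are
eventually uniform in `n`. Under (1), the reachable node lifts all agents, and lowers them by the
symmetry `y ↦ -y`; under (2), each pair closes its gap over a single arrow. Either way (`Contracts`)
the spread shrinks by a fixed factor on all late windows. It never grows between them, so it tends
to zero, and nested intervals give convergence. -/

/-! ### Absolutely continuous functions and Grönwall's inequality. -/

/-- Composing with a Lipschitz function preserves absolute continuity. -/
theorem _root_.LipschitzOnWith.comp_absolutelyContinuousOnInterval {X Y : Type*}
    [PseudoMetricSpace X] [PseudoMetricSpace Y] {g : X → Y} {S : Set X} {K : ℝ≥0}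
    (hg : LipschitzOnWith K g S) {f : ℝ → X} {a b : ℝ}
    (hf : AbsolutelyContinuousOnInterval f a b) (hS : MapsTo f (uIcc a b) S) :
    AbsolutelyContinuousOnInterval (fun t => g (f t)) a b := by
  rw [absolutelyContinuousOnInterval_iff] at hf ⊢
  intro ε hε
  obtain ⟨δ, hδ, h⟩ := hf (ε / (K + 1)) (by positivity)
  refine ⟨δ, hδ, fun E hE hlen => ?_⟩
  have h1 := h E hE hlen
  calc ∑ i ∈ Finset.range E.1, dist (g (f (E.2 i).1)) (g (f (E.2 i).2))
      ≤ ∑ i ∈ Finset.range E.1, K * dist (f (E.2 i).1) (f (E.2 i).2) := by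
        refine Finset.sum_le_sum fun i hi => ?_
        exact hg.dist_le_mul _ (hS (hE.1 i hi).1) _ (hS (hE.1 i hi).2)
    _ = K * ∑ i ∈ Finset.range E.1, dist (f (E.2 i).1) (f (E.2 i).2) := by
        rw [Finset.mul_sum]
    _ ≤ K * (ε / (K + 1)) := by gcongr
    _ < (K + 1) * (ε / (K + 1)) := by gcongr; linarith
    _ = ε := by field

/-- An absolutely continuous function grows at least as fast as an integrable lower bound of its
derivative. -/
theorem integral_le_sub_of_le_deriv {f h : ℝ → ℝ} {a b : ℝ} (hab : a ≤ b)
    (hf : AbsolutelyContinuousOnInterval f a b) (hh : IntervalIntegrable h volume a b)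
    (hd : ∀ᵐ t, t ∈ Icc a b → ∃ f', HasDerivAt f f' t ∧ h t ≤ f') :
    ∫ t in a..b, h t ≤ f b - f a := by
  rw [← hf.integral_deriv_eq_sub]
  refine intervalIntegral.integral_mono_ae_restrict hab hh hf.intervalIntegrable_deriv ?_
  rw [EventuallyLE, ae_restrict_iff' measurableSet_Icc]
  filter_upwards [hd] with t ht hmem
  obtain ⟨f', h1, h2⟩ := ht hmem
  rwa [h1.deriv]

/-- Grönwall's inequality for absolutely continuous functions, with a forcing term. -/
theorem gronwall_forced {f g α : ℝ → ℝ} {a b : ℝ} (hab : a ≤ b)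
    (hf : AbsolutelyContinuousOnInterval f a b) (hg : IntervalIntegrable g volume a b)
    (hα : IntervalIntegrable α volume a b)
    (hge : ∀ᵐ t, t ∈ Icc a b → g t ≤ Real.exp (∫ s in a..t, α s) * g t)
    (hd : ∀ᵐ t, t ∈ Icc a b → ∃ f', HasDerivAt f f' t ∧ g t - α t * f t ≤ f') :
    f a + ∫ t in a..b, g t ≤ f b * Real.exp (∫ t in a..b, α t) := by
  -- Integrating factor: `(f E)' ≥ E g ≥ g`. The last inequality is `hge`, which covers both `g = 0`
  -- with `α` of any sign and `g, α ≥ 0`.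
  set E : ℝ → ℝ := fun t => Real.exp (∫ s in a..t, α s)
  have hI : AbsolutelyContinuousOnInterval (fun t => ∫ s in a..t, α s) a b :=
    hα.absolutelyContinuousOnInterval_intervalIntegral (by simp)
  have hE : AbsolutelyContinuousOnInterval E a b := by
    obtain ⟨C, hC⟩ := hI.exists_bound
    have hLip : ∃ K, LipschitzOnWith K Real.exp (Icc (-C) C) :=
      (Real.contDiff_exp.contDiffOn).exists_lipschitzOnWith one_ne_zero (convex_Icc _ _)
        isCompact_Icc
    obtain ⟨K, hK⟩ := hLip
    exact hK.comp_absolutelyContinuousOnInterval hI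
      fun t ht => abs_le.mp (by simpa using hC t ht)
  have key := integral_le_sub_of_le_deriv (f := fun t => f t * E t) hab (hf.fun_mul hE) hg ?_
  · simp only [E, intervalIntegral.integral_same, Real.exp_zero, mul_one] at key
    linarith
  filter_upwards [hd, hge, hα.ae_hasDerivAt_integral] with t h1 h2 h3 ht
  obtain ⟨f', hf', hle⟩ := h1 ht
  have h4 := (h3 (by rwa [uIcc_of_le hab]) a (by simp)).exp
  refine ⟨_, hf'.mul h4, (h2 ht).trans ?_⟩
  have : 0 < Real.exp (∫ s in a..t, α s) := Real.exp_pos _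
  change E t * g t ≤ f' * E t + f t * (E t * α t)
  have := mul_le_mul_of_nonneg_left hle this.le
  change E t * _ ≤ E t * _ at this
  linarith

theorem intervalIntegrable_fun_sum {ι : Type*} (s : Finset ι) {f : ι → ℝ → ℝ} {a b : ℝ}
    (h : ∀ i ∈ s, IntervalIntegrable (f i) volume a b) :
    IntervalIntegrable (fun t => ∑ i ∈ s, f i t) volume a b := by
  simpa only [← Finset.sum_apply] using! IntervalIntegrable.sum s h

/-! ### The scalar linear consensus system. -/

/-- `u` is a Carathéodory solution on `[a, b]` of the scalar linear system
`u_j' = ∑_k A_{jk}(t) (u_k - u_j)` with nonnegative integrable coefficients. -/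
structure IsScalarSolution {N : ℕ} (A : Fin N → Fin N → ℝ → ℝ) (u : Fin N → ℝ → ℝ)
    (a b : ℝ) : Prop where
  le : a ≤ b
  ac : ∀ j, AbsolutelyContinuousOnInterval (u j) a b
  integrable : ∀ j k, IntervalIntegrable (A j k) volume a b
  nonneg : ∀ j k, ∀ t ∈ Icc a b, 0 ≤ A j k t
  ode : ∀ᵐ t, t ∈ Icc a b → ∀ j, HasDerivAt (u j) (∑ k, A j k t * (u k t - u j t)) t

namespace IsScalarSolution

variable {N : ℕ} {A : Fin N → Fin N → ℝ → ℝ} {u : Fin N → ℝ → ℝ} {a b : ℝ}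

theorem mono (h : IsScalarSolution A u a b) {t : ℝ} (ht : t ∈ Icc a b) :
    IsScalarSolution A u a t where
  le := ht.1
  ac j := (h.ac j).mono (by
    rw [uIcc_of_le ht.1, uIcc_of_le h.le]; exact Icc_subset_Icc_right ht.2)
  integrable j k := (h.integrable j k).mono_set (by
    rw [uIcc_of_le ht.1, uIcc_of_le h.le]; exact Icc_subset_Icc_right ht.2)
  nonneg j k s hs := h.nonneg j k s ⟨hs.1, hs.2.trans ht.2⟩
  ode := by
    filter_upwards [h.ode] with s hs hmem
    exact hs ⟨hmem.1, hmem.2.trans ht.2⟩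

theorem neg (h : IsScalarSolution A u a b) : IsScalarSolution A (fun j t => -u j t) a b where
  le := h.le
  ac j := (h.ac j).neg
  integrable := h.integrable
  nonneg := h.nonneg
  ode := by
    filter_upwards [h.ode] with t ht hmem j
    convert! (ht hmem j).neg using 1
    rw [← Finset.sum_neg_distrib]
    exact Finset.sum_congr rfl fun k _ => by ring

theorem sub_const (h : IsScalarSolution A u a b) (m : ℝ) :
    IsScalarSolution A (fun j t => u j t - m) a b where
  le := h.le
  ac j := (LipschitzWith.of_le_add_mul 1 (fun p q => by
    have := le_abs_self (p - q)
    rw [Real.dist_eq]; simp only [NNReal.coe_one, one_mul]; linarith) :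
      LipschitzWith 1 fun v : ℝ => v - m).lipschitzOnWith.comp_absolutelyContinuousOnInterval
        (h.ac j) (mapsTo_univ _ _)
  integrable := h.integrable
  nonneg := h.nonneg
  ode := by
    filter_upwards [h.ode] with t ht hmem j
    convert! (ht hmem j).sub_const m using 1
    exact Finset.sum_congr rfl fun k _ => by ring

/-- Nonnegativity is preserved. -/
theorem nonneg_right (h : IsScalarSolution A u a b) (h0 : ∀ j, 0 ≤ u j a) (j : Fin N) :
    0 ≤ u j b := by
  -- The squared negative parts are differentiable even at zero, and `f = -∑ q_j²` satisfies `f' ≥ α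
  -- f` with `f a = 0`, so Grönwall forces `q = 0` at `b`.
  set q : Fin N → ℝ → ℝ := fun j t => min (u j t) 0
  set w : ℝ → ℝ := fun t => ∑ j, q j t * q j t
  set α : ℝ → ℝ := fun t => ∑ j, ∑ k, A j k t
  have hq : ∀ j, AbsolutelyContinuousOnInterval (q j) a b := fun j =>
    (LipschitzWith.id.min_const (0 : ℝ)).lipschitzOnWith.comp_absolutelyContinuousOnInterval
      (h.ac j) (mapsTo_univ _ _)
  have hac : ∀ s : Finset (Fin N),
      AbsolutelyContinuousOnInterval (fun t => ∑ j ∈ s, -(q j t * q j t)) a b := by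
    intro s
    induction s using Finset.induction_on with
    | empty =>
      simp only [Finset.sum_empty]
      exact (LipschitzWith.const (0 : ℝ)).lipschitzOnWith.absolutelyContinuousOnInterval
    | insert i s hi ih =>
      simp only [Finset.sum_insert hi]
      exact ((hq i).fun_mul (hq i)).neg.add ih
  have hα : IntervalIntegrable α volume a b :=
    intervalIntegrable_fun_sum _ fun j _ => intervalIntegrable_fun_sum _ fun k _ => h.integrable j k
  have hsq : ∀ v : ℝ, HasDerivAt (fun v : ℝ => min v 0 * min v 0) (2 * min v 0) v := by
    intro v
    rcases lt_trichotomy v 0 with hv | hv | hv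
    · have : HasDerivAt (fun v : ℝ => v * v) (2 * min v 0) v := by
        rw [min_eq_left hv.le]
        convert! (hasDerivAt_id v).mul (hasDerivAt_id v) using 1
        simp; ring
      refine this.congr_of_eventuallyEq ?_
      filter_upwards [Iio_mem_nhds hv] with z hz
      rw [min_eq_left (le_of_lt hz)]
    · subst hv
      rw [hasDerivAt_iff_isLittleO]
      simp only [min_self, mul_zero, sub_zero, smul_zero]
      rw [Asymptotics.isLittleO_iff]
      intro c hc
      filter_upwards [Ioo_mem_nhds (neg_lt_zero.mpr hc) hc] with z hz
      simp only [norm_mul, Real.norm_eq_abs]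
      have h1 : |min z 0| ≤ |z| := by
        rcases le_total z 0 with h | h
        · rw [min_eq_left h]
        · rw [min_eq_right h]; simp
      have h2 : |z| ≤ c := abs_le.mpr ⟨hz.1.le, hz.2.le⟩
      exact mul_le_mul (h1.trans h2) h1 (abs_nonneg _) hc.le
    · have : HasDerivAt (fun _ : ℝ => (0 : ℝ)) (2 * min v 0) v := by
        rw [min_eq_right hv.le, mul_zero]; exact hasDerivAt_const _ _
      refine this.congr_of_eventuallyEq ?_
      filter_upwards [Ioi_mem_nhds hv] with z hz
      rw [min_eq_right (le_of_lt hz), mul_zero]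
  have key := gronwall_forced (f := fun t => ∑ j, -(q j t * q j t)) (g := fun _ => 0)
    (α := fun t => -α t) h.le (hac _) (by simp) hα.neg (.of_forall fun t _ => by simp) ?_
  · have h1 : ∀ j, q j a = 0 := fun j => min_eq_right (h0 j)
    simp only [h1, mul_zero, neg_zero, Finset.sum_const_zero,
      intervalIntegral.integral_zero, add_zero] at key
    have h2 : 0 ≤ ∑ j, -(q j b * q j b) := nonneg_of_mul_nonneg_left key (Real.exp_pos _)
    have h3 : q j b * q j b ≤ ∑ j, q j b * q j b :=
      Finset.single_le_sum (fun i _ => mul_self_nonneg (q i b)) (Finset.mem_univ j)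
    rw [Finset.sum_neg_distrib] at h2
    have h4 : q j b = 0 := by
      have := mul_self_nonneg (q j b)
      exact mul_self_eq_zero.mp (by linarith)
    exact min_eq_right_iff.mp h4
  filter_upwards [h.ode] with t ht hmem
  refine ⟨_, HasDerivAt.fun_sum fun j _ => (((hsq (u j t)).comp t (ht hmem j)).neg), ?_⟩
  have hle : ∀ j k, A j k t * -(∑ i, q i t * q i t) ≤
      -(2 * min (u j t) 0 * (A j k t * (u k t - u j t))) := by
    intro j k
    have hA := h.nonneg j k t hmem
    have h1 : q k t * q k t ≤ ∑ i, q i t * q i t :=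
      Finset.single_le_sum (fun i _ => mul_self_nonneg (q i t)) (Finset.mem_univ k)
    -- As `q_j ≤ 0`, `q_k ≤ u_k` and `q_j u_j = q_j²`, the left side is at most `2 q_j q_k - 2 q_j²
    -- ≤ q_k² - q_j²`.
    have h2 : 2 * q j t * (u k t - u j t) ≤ q k t * q k t := by
      have hk : q k t ≤ u k t := min_le_left _ _
      have hj : q j t ≤ 0 := min_le_right _ _
      have hjj : q j t * u j t = q j t * q j t := by
        rcases le_total (u j t) 0 with h | h
        · simp [q, min_eq_left h]
        · simp [q, min_eq_right h]
      nlinarith [sq_nonneg (q j t - q k t), sq_nonneg (q j t)]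
    have : 2 * q j t * (u k t - u j t) ≤ ∑ i, q i t * q i t := h2.trans h1
    have := mul_le_mul_of_nonneg_left this hA
    change _ ≤ -(2 * q j t * _)
    linarith
  calc 0 - -α t * ∑ j, -(q j t * q j t)
      = ∑ j, ∑ k, A j k t * -(∑ i, q i t * q i t) := by
        simp only [α, ← Finset.sum_mul, Finset.sum_neg_distrib]; ring
    _ ≤ _ := Finset.sum_le_sum fun j _ => by
        rw [Finset.mul_sum]
        exact (Finset.sum_le_sum fun k _ => hle j k).trans_eq (Finset.sum_neg_distrib _)

/-- A nonnegative solution decays at most exponentially, and an agent `k` bounded below lifts the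
agents listening to it. -/
theorem add_mul_integral_le (h : IsScalarSolution A u a b) (h0 : ∀ j, 0 ≤ u j a) (j k : Fin N)
    {ε : ℝ} (hε : 0 ≤ ε) (hk : ∀ t ∈ Icc a b, ε ≤ u k t) :
    u j a + ε * ∫ t in a..b, A j k t ≤ u j b * Real.exp (∫ t in a..b, ∑ i, A j i t) := by
  rw [← intervalIntegral.integral_const_mul]
  refine gronwall_forced h.le (h.ac j) ((h.integrable j k).const_mul ε)
    (intervalIntegrable_fun_sum _ fun i _ => h.integrable j i) ?_ ?_
  · refine .of_forall fun t ht => ?_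
    refine le_mul_of_one_le_left (mul_nonneg hε (h.nonneg j k t ht)) (Real.one_le_exp ?_)
    exact intervalIntegral.integral_nonneg ht.1 fun s hs =>
      Finset.sum_nonneg fun i _ => h.nonneg j i s ⟨hs.1, hs.2.trans ht.2⟩
  · filter_upwards [h.ode] with t ht hmem
    refine ⟨_, ht hmem j, ?_⟩
    have hpos : ∀ i, 0 ≤ u i t := (h.mono hmem).nonneg_right h0
    have h1 : ε * A j k t ≤ ∑ i, A j i t * u i t :=
      calc ε * A j k t ≤ A j k t * u k t := by
            rw [mul_comm]; exact mul_le_mul_of_nonneg_left (hk t hmem) (h.nonneg j k t hmem)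
        _ ≤ _ := Finset.single_le_sum (f := fun i => A j i t * u i t)
            (fun i _ => mul_nonneg (h.nonneg j i t hmem) (hpos i)) (Finset.mem_univ k)
    simp only [mul_sub, Finset.sum_sub_distrib, ← Finset.sum_mul]
    linarith

end IsScalarSolution

/-! ### From limit connections to finite windows. -/

/-- By countable subadditivity some bounded window already carries mass. Halving it makes the bound
strict, so that it passes from the limit to the translates. -/
theorem exists_integral_pos {f : ℝ → ℝ} (hf : IsConnection f) {t₀ : ℝ} (ht₀ : 0 ≤ t₀)
    (hpos : 0 < ∫⁻ s in Ioi t₀, ENNReal.ofReal (f s)) :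
    ∃ T, t₀ ≤ T ∧ ∃ κ, 0 < κ ∧ ∀ T', T ≤ T' → κ < ∫ s in t₀..T', f s := by
  have hU : Ioi t₀ = ⋃ n : ℕ, Ioc t₀ (t₀ + n) := by
    ext x
    simp only [mem_Ioi, mem_iUnion, mem_Ioc]
    refine ⟨fun hx => ?_, fun ⟨_, h⟩ => h.1⟩
    obtain ⟨n, hn⟩ := exists_nat_ge (x - t₀)
    exact ⟨n, hx, by linarith⟩
  obtain ⟨n, hn⟩ : ∃ n : ℕ, ∫⁻ s in Ioc t₀ (t₀ + n), ENNReal.ofReal (f s) ≠ 0 := by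
    by_contra! hcon
    have := lintegral_iUnion_le (μ := volume) (fun n : ℕ => Ioc t₀ (t₀ + n))
      (fun s => ENNReal.ofReal (f s))
    rw [← hU] at this
    simp only [hcon, tsum_zero] at this
    exact absurd hpos (not_lt.mpr this)
  have hint : ∀ T, IntegrableOn f (Ioc t₀ T) := fun T =>
    (hf.2 T).mono_set fun x hx => ⟨ht₀.trans hx.1.le, hx.2⟩
  have hnn : ∀ T, 0 ≤ᵐ[volume.restrict (Ioc t₀ T)] f := fun T =>
    ae_restrict_of_ae_restrict_of_subset (fun x hx => ht₀.trans hx.1.le) hf.1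
  have h0 : (0 : ℝ) ≤ n := n.cast_nonneg
  have hn' : 0 < ∫ s in Ioc t₀ (t₀ + n), f s := by
    rw [← ENNReal.ofReal_pos, ofReal_integral_eq_lintegral_ofReal (hint _) (hnn _)]
    exact pos_iff_ne_zero.mpr hn
  refine ⟨t₀ + n, by linarith, _, half_pos hn', fun T' hT' => (half_lt_self hn').trans_le ?_⟩
  rw [intervalIntegral.integral_of_le (by linarith)]
  exact setIntegral_mono_set (hint _) (hnn _) (Ioc_subset_Ioc_right hT').eventuallyLE

theorem IsLimitAlong.eventually_lt_integral {N : ℕ} {c cstar : Fin N → Fin N → ℝ → ℝ} {s : ℕ → ℝ}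
    (h : IsLimitAlong c s cstar) {j k : Fin N} {p q κ : ℝ} (hp : 0 ≤ p) (hpq : p ≤ q)
    (hκ : κ < ∫ t in p..q, cstar j k t) :
    ∀ᶠ n in atTop, κ < ∫ t in (s n + p)..(s n + q), c j k t := by
  filter_upwards [(h.converges j k p q hp hpq).eventually_const_lt hκ] with n hn
  rwa [intervalIntegral.integral_comp_add_left (fun t => c j k t)] at hn

/-! ### Diffusion estimates and contraction of the spread. -/

/-- The lower estimates satisfied by the solutions of a consensus system whose coefficients are at
least `c` and whose row sums are at most `L`: lower bounds are preserved, and an agent `k` that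
stays above the lower bound lifts the agents listening to it. -/
structure Diffuses {N : ℕ} (c : Fin N → Fin N → ℝ → ℝ) (L : ℝ) (y : Fin N → ℝ → ℝ) : Prop where
  lower : ∀ r t m, 0 ≤ r → r ≤ t → (∀ i, m ≤ y i r) → ∀ i, m ≤ y i t
  lift : ∀ r t m ε j k, 0 ≤ r → r ≤ t → (∀ i, m ≤ y i r) → 0 ≤ ε →
    (∀ s ∈ Icc r t, m + ε ≤ y k s) →
      (y j r - m) + ε * ∫ s in r..t, c j k s ≤ (y j t - m) * Real.exp (L * (t - r))

namespace Diffuses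

variable {N : ℕ} {c cstar : Fin N → Fin N → ℝ → ℝ} {L : ℝ} {y : Fin N → ℝ → ℝ} {σ : ℕ → ℝ}

theorem decay (h : Diffuses c L y) {r t m : ℝ} (hr : 0 ≤ r) (hrt : r ≤ t) (hm : ∀ i, m ≤ y i r)
    (j : Fin N) : y j r - m ≤ (y j t - m) * Real.exp (L * (t - r)) := by
  simpa using h.lift r t m 0 j j hr hrt hm le_rfl fun s hs => by
    simpa using h.lower r s m hr hs.1 hm j

theorem decay' (h : Diffuses c L y) {r t T m : ℝ} (hL : 0 ≤ L) (hr : 0 ≤ r) (hrt : r ≤ t)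
    (hT : t ≤ r + T) (hm : ∀ i, m ≤ y i r)
    (j : Fin N) : Real.exp (-(L * T)) * (y j r - m) ≤ y j t - m := by
  have h1 := h.decay hr hrt hm j
  have h2 : Real.exp (L * (t - r)) ≤ Real.exp (L * T) :=
    Real.exp_le_exp.mpr (mul_le_mul_of_nonneg_left (by linarith) hL)
  have h3 := h.lower r t m hr hrt hm j
  rw [Real.exp_neg, inv_mul_le_iff₀ (Real.exp_pos _)]
  nlinarith

/-- The distances of all agents from a lower bound are, after a fixed time, at least a fixed
fraction of the initial distance of a globally reachable agent. -/
theorem exists_lift_of_reachable (hlim : IsLimitAlong c σ cstar) (hL : 0 ≤ L) {l i : Fin N}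
    (hi : Relation.ReflTransGen (recurrentGraph cstar).Adj i l) :
    ∃ T ε : ℝ, 0 < T ∧ 0 < ε ∧ ∀ᶠ n in atTop, ∀ y, Diffuses c L y → ∀ m, (∀ i, m ≤ y i (σ n)) →
      ε * (y l (σ n) - m) ≤ y i (σ n + T) - m := by
  induction hi using Relation.ReflTransGen.head_induction_on with
  | refl =>
    -- A positive time is needed because recurrent arrows only speak of tails from `t > 0`.
    refine ⟨1, Real.exp (-(L * 1)), one_pos, Real.exp_pos _, .of_forall fun n y hy m hm => ?_⟩
    exact hy.decay' hL (hlim.nonneg n) (by linarith) le_rfl hm l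
  | @head i k hik _ ih =>
    -- Recurrence of `i → k` supplies a window starting at `T`, when `k` has already been lifted.
    -- One exponential factor is the decay of `k` during that window, the other that of `i`.
    obtain ⟨T, ε, hT, hε, hev⟩ := ih
    obtain ⟨T', hTT', κ, hκ, hint⟩ := exists_integral_pos (hlim.connection_star i k) hT.le
      (hik T hT)
    refine ⟨T', Real.exp (-(L * (T' - T))) * ((Real.exp (-(L * (T' - T))) * ε) * κ),
      hT.trans_le hTT', by positivity, ?_⟩
    filter_upwards [hev, hlim.eventually_lt_integral hT.le hTT' (hint T' le_rfl)]
      with n hn hκn y hy m hm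
    have hσ := hlim.nonneg n
    have hm' := hy.lower (σ n) (σ n + T) m hσ (by linarith) hm
    set d := y l (σ n) - m
    have hd : 0 ≤ d := sub_nonneg.mpr (hm l)
    have h1 := hn y hy m hm
    set η := Real.exp (-(L * (T' - T))) * ε * d
    have hη : 0 ≤ η := by positivity
    have h2 := hy.lift (σ n + T) (σ n + T') m η i k (by linarith) (by linarith) hm' hη
      fun s hs => by
        have h3 := hy.decay' (t := s) (T := T' - T) hL (by linarith) hs.1 (by linarith [hs.2])
          hm' k
        have h4 : η ≤ Real.exp (-(L * (T' - T))) * (y k (σ n + T) - m) := by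
          simp only [η, mul_assoc]
          exact mul_le_mul_of_nonneg_left h1 (Real.exp_pos _).le
        linarith
    have h5 : η * κ ≤ (y i (σ n + T') - m) * Real.exp (L * (T' - T)) := by
      have h6 := mul_le_mul_of_nonneg_left hκn.le hη
      have h7 := sub_nonneg.mpr (hm' i)
      rw [show σ n + T' - (σ n + T) = T' - T by ring] at h2
      linarith
    calc Real.exp (-(L * (T' - T))) * (Real.exp (-(L * (T' - T))) * ε * κ) * d
        = Real.exp (-(L * (T' - T))) * (η * κ) := by simp only [η]; ring
      _ ≤ y i (σ n + T') - m := by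
        rw [Real.exp_neg (L * (T' - T)), inv_mul_le_iff₀ (Real.exp_pos _)]
        linarith

/-- For large `n`, agents confined at time `σ n` to an interval of length `δ` satisfy
`y_j - y_k ≤ (1 - ε) δ` at time `σ n + T`. -/
def Contracts (c : Fin N → Fin N → ℝ → ℝ) (L : ℝ) (σ : ℕ → ℝ) (T ε : ℝ) (j k : Fin N) : Prop :=
  ∀ᶠ n in atTop, ∀ y, Diffuses c L y → Diffuses c L (fun i t => -y i t) → ∀ m δ,
    (∀ i, m ≤ y i (σ n)) → (∀ i, y i (σ n) ≤ m + δ) →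
      y j (σ n + T) - y k (σ n + T) ≤ (1 - ε) * δ

theorem exists_pos_le {ι : Type*} [Finite ι] (f : ι → ℝ) (hf : ∀ i, 0 < f i) :
    ∃ ε, 0 < ε ∧ ∀ i, ε ≤ f i := by
  obtain ⟨⟨ε, hε⟩, h⟩ := Finite.exists_ge fun i => (⟨f i, hf i⟩ : Ioi (0 : ℝ))
  exact ⟨ε, hε, h⟩

/-- The lift is used for `y` from below and for `-y` from above, with the same node `l`. Adding the
two estimates cancels the position of `l` and leaves a fixed fraction of `δ`. -/
theorem exists_contracts_of_reachable (hlim : IsLimitAlong c σ cstar) (hL : 0 ≤ L) {l : Fin N}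
    (hl : IsGloballyReachable (recurrentGraph cstar) l) :
    ∃ T ε, 0 ≤ T ∧ 0 < ε ∧ ∀ j k, Contracts c L σ T ε j k := by
  choose T ε hT hε hev using fun i => exists_lift_of_reachable hlim hL (hl i)
  obtain ⟨S, hS⟩ := Finite.exists_le T
  obtain ⟨ε', hε', hle⟩ := exists_pos_le ε hε
  refine ⟨S, Real.exp (-(L * S)) * ε', (hT l).le.trans (hS l), by positivity, fun j k => ?_⟩
  have hfin : ∀ᶠ n in atTop, ∀ y, Diffuses c L y → ∀ m, (∀ i, m ≤ y i (σ n)) → ∀ i,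
      Real.exp (-(L * S)) * ε' * (y l (σ n) - m) ≤ y i (σ n + S) - m := by
    filter_upwards [eventually_all.mpr hev] with n hn y hy m hm i
    have hσ := hlim.nonneg n
    have h1 := hn i y hy m hm
    have h2 := hy.decay' (r := σ n + T i) (t := σ n + S) (T := S) hL
      (by linarith [hT i]) (by linarith [hS i]) (by linarith [hT i])
      (hy.lower (σ n) _ m hσ (by linarith [hT i]) hm) i
    have h3 : ε' * (y l (σ n) - m) ≤ y i (σ n + T i) - m :=
      (mul_le_mul_of_nonneg_right (hle i) (sub_nonneg.mpr (hm l))).trans h1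
    rw [mul_assoc]
    exact (mul_le_mul_of_nonneg_left h3 (Real.exp_pos _).le).trans h2
  filter_upwards [hfin] with n hn y hy hy' m δ hm hM
  have h1 := hn y hy m hm k
  have h2 := hn _ hy' (-(m + δ)) (fun i => neg_le_neg (hM i)) j
  linarith

/-- Either `k` ends well above `m`, or by the decay estimate it was in the lower half throughout and
the arrow `j → k` pulls `j` down. -/
theorem gap_le_of_lift (hL : 0 ≤ L) {T κ : ℝ} (hT : 0 ≤ T) {y : Fin N → ℝ → ℝ}
    (hy : Diffuses c L y) (hy' : Diffuses c L (fun i t => -y i t)) {r m δ : ℝ} (hr : 0 ≤ r)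
    (hm : ∀ i, m ≤ y i r) (hM : ∀ i, y i r ≤ m + δ) {j k : Fin N}
    (hκ : κ ≤ ∫ s in r..(r + T), c j k s) :
    y j (r + T) - y k (r + T) ≤ (1 - Real.exp (-(L * T)) * min 1 κ / 2) * δ := by
  have hδ : 0 ≤ δ := by linarith [hm j, hM j]
  have hrT : r ≤ r + T := by linarith
  set e := Real.exp (-(L * T))
  have he : 0 < e := Real.exp_pos _
  have hM' : ∀ i, -(m + δ) ≤ -y i r := fun i => neg_le_neg (hM i)
  have hj : y j (r + T) ≤ m + δ := by linarith [hy'.lower r (r + T) _ hr hrT hM' j]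
  have hk : m ≤ y k (r + T) := hy.lower r (r + T) _ hr hrT hm k
  rcases le_total (e * (δ / 2)) (y k (r + T) - m) with h | h
  · have : e * min 1 κ / 2 * δ ≤ e * (δ / 2) := by
      have := mul_le_mul_of_nonneg_left (min_le_left 1 κ) (by positivity : 0 ≤ e * (δ / 2))
      linarith
    linarith
  · have hlow : ∀ s ∈ Icc r (r + T), -(m + δ) + δ / 2 ≤ -y k s := by
      intro s hs
      have h1 := hy.decay' (r := s) (t := r + T) (T := T) hL (hr.trans hs.1) hs.2
        (by linarith [hs.1]) (hy.lower r s m hr hs.1 hm) k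
      have h2 : y k s - m ≤ δ / 2 := le_of_mul_le_mul_left (h1.trans h) he
      linarith
    have h1 := hy'.lift r (r + T) (-(m + δ)) (δ / 2) j k hr hrT hM' (by positivity) hlow
    simp only [add_sub_cancel_left] at h1
    have h2 : δ / 2 * min 1 κ ≤ (-y j (r + T) - -(m + δ)) * Real.exp (L * T) := by
      have h3 := mul_le_mul_of_nonneg_left ((min_le_right 1 κ).trans hκ)
        (by positivity : 0 ≤ δ / 2)
      linarith [hM' j]
    have h3 : e * (δ / 2 * min 1 κ) ≤ -y j (r + T) - -(m + δ) := by
      simp only [e]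
      rw [Real.exp_neg, inv_mul_le_iff₀ (Real.exp_pos _)]
      linarith
    linarith

theorem neg_neg (h : Diffuses c L y) : Diffuses c L (fun i t => - -y i t) := by
  simpa only [_root_.neg_neg] using h

theorem exists_contracts_of_pairwise (hlim : IsLimitAlong c σ cstar) (hL : 0 ≤ L)
    (hpair : ∀ j k, j ≠ k → (activeGraph cstar).Adj j k ∨ (activeGraph cstar).Adj k j) :
    ∃ T ε, 0 ≤ T ∧ 0 < ε ∧ ∀ j k, Contracts c L σ T ε j k := by
  have hex : ∀ p : Fin N × Fin N, ∃ T κ : ℝ, 0 ≤ T ∧ 0 < κ ∧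
      ((activeGraph cstar).Adj p.1 p.2 →
        ∀ T', T ≤ T' → κ < ∫ s in (0 : ℝ)..T', cstar p.1 p.2 s) := by
    intro p
    by_cases h : (activeGraph cstar).Adj p.1 p.2
    · obtain ⟨T, hT, κ, hκ, hint⟩ := exists_integral_pos (hlim.connection_star p.1 p.2) le_rfl h
      exact ⟨T, κ, hT, hκ, fun _ => hint⟩
    · exact ⟨0, 1, le_rfl, one_pos, fun h' => absurd h' h⟩
  choose T κ hT hκ hint using hex
  obtain ⟨S₀, hS₀⟩ := Finite.exists_le T
  obtain ⟨κ', hκ', hle⟩ := exists_pos_le κ hκ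
  -- With no agents `S₀` is arbitrary, hence the maximum with zero.
  set S := max S₀ 0
  have hS : ∀ p, T p ≤ S := fun p => (hS₀ p).trans (le_max_left _ _)
  have hS0 : 0 ≤ S := le_max_right _ _
  have hmin : 0 < min 1 κ' := lt_min one_pos hκ'
  -- The bound `ε ≤ 1` serves the diagonal case, where the gap is zero.
  set ε := min 1 (Real.exp (-(L * S)) * min 1 κ' / 2)
  have hε : ε ≤ Real.exp (-(L * S)) * min 1 κ' / 2 := min_le_right _ _
  refine ⟨S, ε, hS0, lt_min one_pos (by positivity), fun j k => ?_⟩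
  have hev : ∀ p : Fin N × Fin N, (activeGraph cstar).Adj p.1 p.2 →
      ∀ᶠ n in atTop, κ' ≤ ∫ s in (σ n)..(σ n + S), c p.1 p.2 s := by
    intro p hp
    filter_upwards [hlim.eventually_lt_integral le_rfl hS0 (hint p hp S (hS p))] with n hn
    rw [add_zero] at hn
    exact (hle p).trans hn.le
  have hδ : ∀ {n : ℕ} {y : Fin N → ℝ → ℝ} {m δ : ℝ}, (∀ i, m ≤ y i (σ n)) →
      (∀ i, y i (σ n) ≤ m + δ) →
        (1 - Real.exp (-(L * S)) * min 1 κ' / 2) * δ ≤ (1 - ε) * δ :=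
    fun hm hM => mul_le_mul_of_nonneg_right (by linarith) (by linarith [hm j, hM j])
  by_cases hjk : j = k
  · subst hjk
    refine .of_forall fun n y hy hy' m δ hm hM => ?_
    rw [sub_self]
    exact mul_nonneg (sub_nonneg.mpr (min_le_left _ _)) (by linarith [hm j, hM j])
  rcases hpair j k hjk with h | h
  · filter_upwards [hev (j, k) h] with n hn y hy hy' m δ hm hM
    exact (gap_le_of_lift hL hS0 hy hy' (hlim.nonneg n) hm hM hn).trans (hδ hm hM)
  · filter_upwards [hev (k, j) h] with n hn y hy hy' m δ hm hM
    have := gap_le_of_lift hL hS0 hy' hy.neg_neg (hlim.nonneg n) (m := -(m + δ)) (δ := δ)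
      (fun i => neg_le_neg (hM i)) (fun i => by linarith [hm i]) hn
    have := this.trans (hδ hm hM)
    linarith

/-- The spread of the agents becomes arbitrarily small. -/
theorem exists_spread_le (hσ : Tendsto σ atTop atTop) (hy : Diffuses c L y)
    (hy' : Diffuses c L (fun i t => -y i t))
    (hc : ∃ T ε, 0 ≤ T ∧ 0 < ε ∧ ∀ j k, Contracts c L σ T ε j k) {η : ℝ} (hη : 0 < η) :
    ∃ τ, 0 ≤ τ ∧ ∀ j k, y j τ - y k τ ≤ η := by
  rcases isEmpty_or_nonempty (Fin N) with hN | hN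
  · exact ⟨0, le_rfl, fun j => hN.elim j⟩
  obtain ⟨T, ε, hT, hε, hcon⟩ := hc
  obtain ⟨D, hD⟩ := Finite.exists_le fun p : Fin N × Fin N => y p.1 0 - y p.2 0
  set q := max (1 - ε) 0
  have hq0 : 0 ≤ q := le_max_right _ _
  have hq1 : q < 1 := max_lt (by linarith) one_pos
  have hstep : ∀ p : ℕ, ∃ τ, 0 ≤ τ ∧ ∀ j k, y j τ - y k τ ≤ q ^ p * D := by
    intro p
    induction p with
    | zero => exact ⟨0, le_rfl, fun j k => by simpa using hD (j, k)⟩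
    | succ p ih =>
      obtain ⟨τ, hτ, hτD⟩ := ih
      -- The threshold for `n` in `Contracts` does not depend on `m` or `δ`, so a window beyond `τ`
      -- serves the current spread.
      obtain ⟨n, hn, hσn⟩ := ((eventually_all.mpr fun j => eventually_all.mpr (hcon j)).and
        (hσ.eventually_ge_atTop τ)).exists
      obtain ⟨i₀, hi₀⟩ := Finite.exists_min fun i => y i τ
      have hup : ∀ i, y i τ ≤ y i₀ τ + q ^ p * D := fun i => by linarith [hτD i i₀]
      refine ⟨σ n + T, by linarith, fun j k => ?_⟩
      have h1 := hn j k y hy hy' (y i₀ τ) (q ^ p * D) (hy.lower τ _ _ hτ hσn hi₀) fun i => by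
        linarith [hy'.lower τ _ _ hτ hσn (fun i => neg_le_neg (hup i)) i]
      have h2 : 0 ≤ q ^ p * D := by linarith [hup i₀]
      calc _ ≤ (1 - ε) * (q ^ p * D) := h1
        _ ≤ q * (q ^ p * D) := mul_le_mul_of_nonneg_right (le_max_left _ _) h2
        _ = q ^ (p + 1) * D := by ring
  have hlim : Tendsto (fun p : ℕ => q ^ p * D) atTop (𝓝 0) := by
    simpa using (tendsto_pow_atTop_nhds_zero_of_lt_one hq0 hq1).mul_const D
  obtain ⟨p, hp⟩ := (hlim.eventually_lt_const hη).exists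
  obtain ⟨τ, hτ, h⟩ := hstep p
  exact ⟨τ, hτ, fun j k => (h j k).trans hp.le⟩

end Diffuses

/-! ### Time change and measurability along a curve. -/

/-- Change of variables along a monotone absolutely continuous function. -/
theorem lintegral_Icc_eq_lintegral_deriv_mul {ρ : ℝ → ℝ} {r t : ℝ} (hrt : r ≤ t)
    (hmono : MonotoneOn ρ (Icc r t)) (hac : AbsolutelyContinuousOnInterval ρ r t)
    (u : ℝ → ENNReal) :
    ∫⁻ s in Icc (ρ r) (ρ t), u s = ∫⁻ τ in Icc r t, ENNReal.ofReal (deriv ρ τ) * u (ρ τ) := by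
  set S : Set ℝ := Icc r t ∩ {τ | DifferentiableAt ℝ ρ τ}
  have hSm : MeasurableSet S := measurableSet_Icc.inter (measurableSet_of_differentiableAt ℝ ρ)
  have hSI : S ⊆ Icc r t := inter_subset_left
  have hS : S =ᵐ[volume] Icc r t := by
    have hdiff := hac.ae_differentiableAt
    rw [uIcc_of_le hrt] at hdiff
    refine hSI.eventuallyLE.antisymm ?_
    filter_upwards [hdiff] with τ hτ hmem using ⟨hmem, hτ hmem⟩
  have hder : ∀ τ ∈ S, HasDerivWithinAt ρ (deriv ρ τ) S τ :=
    fun τ hτ => hτ.2.hasDerivAt.hasDerivWithinAt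
  have hnn : 0 ≤ᵐ[volume.restrict (Ioc r t)] deriv ρ := by
    rw [← Measure.restrict_congr_set Ioo_ae_eq_Ioc]
    filter_upwards [ae_restrict_mem measurableSet_Ioo] with τ hτ
    rw [← derivWithin_of_mem_nhds (Icc_mem_nhds hτ.1 hτ.2)]
    exact hmono.derivWithin_nonneg
  have hle : ρ r ≤ ρ t := hmono (left_mem_Icc.mpr hrt) (right_mem_Icc.mpr hrt) hrt
  have himg : ρ '' S ⊆ Icc (ρ r) (ρ t) := by
    rintro _ ⟨τ, hτ, rfl⟩
    exact ⟨hmono (left_mem_Icc.mpr hrt) hτ.1 hτ.1.1, hmono hτ.1 (right_mem_Icc.mpr hrt) hτ.1.2⟩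
  -- Absolute continuity enters here: `ρ t - ρ r` is the integral of `ρ'`, so the points of
  -- non-differentiability contribute nothing to the image.
  have hvol : volume (ρ '' S) = volume (Icc (ρ r) (ρ t)) := by
    rw [← lintegral_deriv_eq_volume_image_of_monotoneOn hSm hder (hmono.mono hSI),
      setLIntegral_congr (hS.trans Ioc_ae_eq_Icc.symm), Real.volume_Icc,
      ← hac.integral_deriv_eq_sub, intervalIntegral.integral_of_le hrt,
      ofReal_integral_eq_lintegral_ofReal hac.intervalIntegrable_deriv.1 hnn]
  have hae : ρ '' S =ᵐ[volume] Icc (ρ r) (ρ t) :=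
    ae_eq_of_subset_of_measure_ge himg hvol.ge
      (hSm.image_of_monotoneOn (hmono.mono hSI)).nullMeasurableSet (by simp)
  rw [← setLIntegral_congr hae, ← setLIntegral_congr hS]
  exact lintegral_image_eq_lintegral_deriv_mul_of_monotoneOn hSm hder (hmono.mono hSI) u

/-- A universally measurable function composed with a measurable one is a.e. measurable for every
finite measure. -/
theorem UniversallyMeasurable.aemeasurable_comp {α β : Type*} [MeasurableSpace α]
    [MeasurableSpace β] {f : α → ℝ} (hf : UniversallyMeasurable f) {g : β → α}
    (hg : Measurable g) (μ : Measure β) [IsFiniteMeasure μ] :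
    AEMeasurable (fun b => f (g b)) μ := by
  rcases eq_or_ne μ 0 with rfl | hμ
  · exact aemeasurable_zero_measure
  have hν : μ.map g ≠ 0 := by rwa [Ne, Measure.map_eq_zero_iff hg.aemeasurable]
  have : NeZero (μ.map g) := ⟨hν⟩
  have h1 : NullMeasurable f ((μ.map g univ)⁻¹ • μ.map g) := hf _ inferInstance
  have h2 : AEMeasurable f (μ.map g) :=
    h1.aemeasurable.mono_ac (Measure.absolutelyContinuous_smul
      (ENNReal.inv_ne_zero.mpr (measure_ne_top _ _)))
  exact h2.comp_measurable hg

/-- Universal measurability is applied to the image of Lebesgue measure under `s ↦ (s, x s)`.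
Truncating at zero makes this map globally measurable. -/
theorem aemeasurable_along {N d : ℕ} {f : ℝ → State N d → ℝ}
    (hf : UniversallyMeasurable (fun p : ℝ≥0 × State N d => f (p.1 : ℝ) p.2))
    {x : ℝ → State N d} (hx : ContinuousOn x (Ici 0)) {p q : ℝ} (hp : 0 ≤ p) :
    AEMeasurable (fun s => f s (x s)) (volume.restrict (Icc p q)) := by
  have hc : Continuous fun s : ℝ => x (max s 0) :=
    hx.comp_continuous (continuous_id.max continuous_const) fun s => mem_Ici.mpr (le_max_right _ _)
  have hφ : Measurable fun s : ℝ => (s.toNNReal, x (max s 0)) :=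
    measurable_real_toNNReal.prodMk hc.measurable
  refine (hf.aemeasurable_comp hφ (volume.restrict (Icc p q))).congr ?_
  filter_upwards [ae_restrict_mem measurableSet_Icc] with s hs
  have h0 : 0 ≤ s := hp.trans hs.1
  simp only [Real.coe_toNNReal s h0, max_eq_left h0]

/-! ### From scalar solutions to diffusion, and from vanishing spread to a limit. -/

/-- Solutions of the scalar system, reparametrized by `ρ`, satisfy the diffusion estimates. -/
theorem diffuses_of_isScalarSolution {N : ℕ} {A c : Fin N → Fin N → ℝ → ℝ} {u : Fin N → ℝ → ℝ}
    {ρ : ℝ → ℝ} {M : ℝ} (hρ : ContinuousOn ρ (Ici 0))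
    (hu : ∀ r t, 0 ≤ r → r ≤ t → IsScalarSolution A u (ρ r) (ρ t))
    (hM : ∀ r t, 0 ≤ r → r ≤ t → ∀ j k, ∫ s in (ρ r)..(ρ t), A j k s ≤ M * (t - r))
    (hc : ∀ r t, 0 ≤ r → r ≤ t → ∀ j k,
      ∫ s in r..t, c j k s ≤ ∫ s in (ρ r)..(ρ t), A j k s) :
    Diffuses c (N * M) (fun j t => u j (ρ t)) where
  lower r t m hr hrt hm i := by
    have := ((hu r t hr hrt).sub_const m).nonneg_right (fun j => sub_nonneg.mpr (hm j)) i
    exact sub_nonneg.mp this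
  lift r t m ε j k hr hrt hm hε hk := by
    have hs := (hu r t hr hrt).sub_const m
    have h0 : ∀ j, 0 ≤ u j (ρ r) - m := fun j => sub_nonneg.mpr (hm j)
    have h1 := hs.add_mul_integral_le h0 j k hε fun s hmem => by
      obtain ⟨τ, hτ, rfl⟩ := intermediate_value_Icc hrt
        (hρ.mono fun τ hτ => hr.trans hτ.1) hmem
      linarith [hk τ hτ]
    have h2 : ∫ s in (ρ r)..(ρ t), ∑ i, A j i s ≤ N * M * (t - r) := by
      rw [intervalIntegral.integral_finsetSum fun i _ => hs.integrable j i]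
      calc _ ≤ ∑ _i : Fin N, M * (t - r) := Finset.sum_le_sum fun i _ => hM r t hr hrt j i
        _ = N * M * (t - r) := by simp; ring
    have h3 := mul_le_mul_of_nonneg_left (Real.exp_le_exp.mpr h2) (hs.nonneg_right h0 j)
    have h4 := mul_le_mul_of_nonneg_left (hc r t hr hrt j k) hε
    linarith

theorem exists_common_limit {ι : Type*} {X : ι → ℝ → ℝ}
    (h : ∀ η > 0, ∃ S, ∀ s, S ≤ s → ∀ s', S ≤ s' → ∀ j k, X j s - X k s' ≤ η) :
    ∃ l, ∀ j, Tendsto (X j) atTop (𝓝 l) := by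
  rcases isEmpty_or_nonempty ι with hι | ⟨⟨j₀⟩⟩
  · exact ⟨0, fun j => hι.elim j⟩
  have hdist : ∀ η > 0, ∃ S, ∀ s ≥ S, ∀ s' ≥ S, ∀ j k, dist (X j s) (X k s') < η := by
    intro η hη
    obtain ⟨S, hS⟩ := h (η / 2) (half_pos hη)
    refine ⟨S, fun s hs s' hs' j k => ?_⟩
    rw [Real.dist_eq]
    refine (abs_le.mpr ⟨?_, hS s hs s' hs' j k⟩).trans_lt (half_lt_self hη)
    linarith [hS s' hs' s hs k j]
  have hC : CauchySeq (X j₀) := Metric.cauchySeq_iff.mpr fun η hη => by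
    obtain ⟨S, hS⟩ := hdist η hη
    exact ⟨S, fun s hs s' hs' => hS s hs s' hs' j₀ j₀⟩
  obtain ⟨l, hl⟩ := cauchySeq_tendsto_of_complete hC
  refine ⟨l, fun j => tendsto_of_tendsto_of_dist hl (Metric.tendsto_atTop.mpr fun η hη => ?_)⟩
  obtain ⟨S, hS⟩ := hdist η hη
  refine ⟨S, fun s hs => ?_⟩
  rw [Real.dist_0_eq_abs, abs_of_nonneg dist_nonneg]
  exact hS s hs s hs j₀ j

/-- If the spread of a diffusing reparametrized family becomes arbitrarily small, the family
converges to a common limit. -/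
theorem exists_limit_of_diffuses {N : ℕ} {c : Fin N → Fin N → ℝ → ℝ} {u : Fin N → ℝ → ℝ}
    {ρ : ℝ → ℝ} {L : ℝ} (hρ : ContinuousOn ρ (Ici 0)) (hρ_top : Tendsto ρ atTop atTop)
    (hu : Diffuses c L (fun j t => u j (ρ t))) (hu' : Diffuses c L (fun j t => -u j (ρ t)))
    (h : ∀ η > 0, ∃ τ, 0 ≤ τ ∧ ∀ j k, u j (ρ τ) - u k (ρ τ) ≤ η) :
    ∃ l, ∀ j, Tendsto (u j) atTop (𝓝 l) := by
  rcases isEmpty_or_nonempty (Fin N) with hN | hN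
  · exact ⟨0, fun j => hN.elim j⟩
  refine exists_common_limit fun η hη => ?_
  obtain ⟨τ, hτ, hsp⟩ := h η hη
  obtain ⟨i₀, hi₀⟩ := Finite.exists_min fun i => u i (ρ τ)
  have hmem : ∀ s, ρ τ ≤ s → ∀ j, u i₀ (ρ τ) ≤ u j s ∧ u j s ≤ u i₀ (ρ τ) + η := by
    intro s hs j
    -- Every `s ≥ ρ τ` is `ρ t` for some `t ≥ τ` by continuity, so `ρ` need not be injective.
    obtain ⟨t₁, ht₁, ht₁'⟩ := ((hρ_top.eventually_ge_atTop s).and (eventually_ge_atTop τ)).exists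
    obtain ⟨t, ht, rfl⟩ := intermediate_value_Icc ht₁'
      (hρ.mono fun τ' hτ' => hτ.trans hτ'.1) ⟨hs, ht₁⟩
    refine ⟨hu.lower τ t _ hτ ht.1 hi₀ j, ?_⟩
    have := hu'.lower τ t (-(u i₀ (ρ τ) + η)) hτ ht.1 (fun i => by linarith [hsp i i₀]) j
    linarith
  exact ⟨ρ τ, fun s hs s' hs' j k => by linarith [(hmem s hs j).2, (hmem s' hs' k).1]⟩

/-! ### Trajectories of the nonlinear system. -/

theorem continuousOn_Ici_of_absolutelyContinuous {X : Type*} [SeminormedAddCommGroup X] {f : ℝ → X}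
    (hf : ∀ T : ℝ, 0 ≤ T → AbsolutelyContinuousOnInterval f 0 T) : ContinuousOn f (Ici 0) := by
  intro s hs
  have hs0 : (0 : ℝ) ≤ s := hs
  have hs1 : 0 ≤ s + 1 := by linarith
  have h1 : ContinuousOn f (Icc 0 (s + 1)) := uIcc_of_le hs1 ▸ (hf (s + 1) hs1).continuousOn
  have h2 : ContinuousWithinAt f (Icc 0 (s + 1)) s := h1 s ⟨hs0, (lt_add_one s).le⟩
  refine h2.mono_of_mem_nhdsWithin ?_
  have h3 : Iio (s + 1) ∈ 𝓝[Ici 0] s :=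
    mem_nhdsWithin_of_mem_nhds (Iio_mem_nhds (lt_add_one s))
  filter_upwards [self_mem_nhdsWithin, h3] with z hz hz'
  exact ⟨hz, le_of_lt hz'⟩

theorem IsTrajectory.continuousOn {N d : ℕ} {a : Fin N → Fin N → ℝ → State N d → ℝ}
    {x : ℝ → State N d} (hx : IsTrajectory a x) : ContinuousOn x (Ici 0) :=
  continuousOn_pi.mpr fun j =>
    continuousOn_Ici_of_absolutelyContinuous fun T hT => hx.1 T hT j

theorem IsTrajectory.isScalarSolution {N d : ℕ} {a : Fin N → Fin N → ℝ → State N d → ℝ}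
    (ha : ∀ j k t x, 0 ≤ t → 0 ≤ a j k t x) {x : ℝ → State N d} (hx : IsTrajectory a x)
    {p q : ℝ} (hp : 0 ≤ p) (hpq : p ≤ q)
    (hint : ∀ j k, IntervalIntegrable (fun s => a j k s (x s)) volume p q) (i : Fin d) :
    IsScalarSolution (fun j k s => a j k s (x s)) (fun j s => x s j i) p q where
  le := hpq
  ac j := by
    have h1 := (hx.1 q (hp.trans hpq) j).mono (c := p) (d := q) (by
      rw [uIcc_of_le hpq, uIcc_of_le (hp.trans hpq)]; exact Icc_subset_Icc_left hp)
    exact (EuclideanSpace.proj (𝕜 := ℝ) i : EuclideanSpace ℝ (Fin d) →L[ℝ] ℝ).lipschitz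
      |>.lipschitzOnWith.comp_absolutelyContinuousOnInterval h1 (mapsTo_univ _ _)
  integrable := hint
  nonneg j k s hs := ha j k s _ (hp.trans hs.1)
  ode := by
    have h1 := hx.2
    rw [ae_restrict_iff' measurableSet_Ici] at h1
    filter_upwards [h1] with t ht hmem j
    have h2 := (EuclideanSpace.proj (𝕜 := ℝ) i :
      EuclideanSpace ℝ (Fin d) →L[ℝ] ℝ).hasFDerivAt.comp_hasDerivAt t
        (ht (hp.trans hmem.1) j)
    convert! h2 using 1
    simp

theorem exists_contracts {N : ℕ} {c : Fin N → Fin N → ℝ → ℝ} {L : ℝ} (hL : 0 ≤ L)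
    (h : ReachableCondition c ∨ PairwiseCondition c) :
    ∃ σ cstar, IsLimitAlong c σ cstar ∧
      ∃ T ε, 0 ≤ T ∧ 0 < ε ∧ ∀ j k, Diffuses.Contracts c L σ T ε j k := by
  rcases h with ⟨σ, cstar, hlim, l, hl⟩ | ⟨σ, cstar, hlim, hpair⟩
  · exact ⟨σ, cstar, hlim, Diffuses.exists_contracts_of_reachable hlim hL hl⟩
  · exact ⟨σ, cstar, hlim, Diffuses.exists_contracts_of_pairwise hlim hL hpair⟩

/-- Nonnegativity bounds the family below, without which the real infimum is a default value. At `t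
= 0` the two-sided `deriv ρ` may involve negative times, hence `0 < t`. -/
theorem rescaledEnvelope_le {N d : ℕ} {a : Fin N → Fin N → ℝ → State N d → ℝ}
    (ha : ∀ j k t x, 0 ≤ t → 0 ≤ a j k t x) {ρ : ℝ → ℝ} (hρ_maps : MapsTo ρ (Ici 0) (Ici 0))
    (hρ_mono : MonotoneOn ρ (Ici 0)) (j k : Fin N) {t : ℝ} (ht : 0 < t) (x : State N d) :
    rescaledEnvelope a ρ j k t ≤ a j k (ρ t) x * deriv ρ t := by
  have hder : 0 ≤ deriv ρ t := by
    rw [← derivWithin_of_mem_nhds (Ici_mem_nhds ht)]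
    exact hρ_mono.derivWithin_nonneg
  refine ciInf_le ⟨0, ?_⟩ x
  rintro _ ⟨y, rfl⟩
  exact mul_nonneg (ha j k _ y (hρ_maps ht.le)) hder

/-- The integrals of the coefficients along a curve, in the original time, are controlled by the
bounds on the rescaled coefficients. -/
theorem integral_coefficient_bounds {N d : ℕ} {a : Fin N → Fin N → ℝ → State N d → ℝ}
    (ha : ∀ j k t x, 0 ≤ t → 0 ≤ a j k t x)
    (ha_meas : ∀ j k, UniversallyMeasurable
      (fun p : ℝ≥0 × State N d => a j k (p.1 : ℝ) p.2))
    {ρ : ℝ → ℝ} (hρ_maps : MapsTo ρ (Ici 0) (Ici 0)) (hρ_mono : MonotoneOn ρ (Ici 0))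
    (hρ_ac : ∀ T : ℝ, 0 ≤ T → AbsolutelyContinuousOnInterval ρ 0 T) {j k : Fin N} {M : ℝ}
    (hM : ∀ᵐ t ∂(volume.restrict (Ici (0 : ℝ))), ∀ x, a j k (ρ t) x * deriv ρ t ≤ M)
    (hM0 : 0 ≤ M)
    (hconn : IsConnection (rescaledEnvelope a ρ j k)) {x : ℝ → State N d}
    (hx : ContinuousOn x (Ici 0)) {r t : ℝ} (hr : 0 ≤ r) (hrt : r ≤ t) :
    IntervalIntegrable (fun s => a j k s (x s)) volume (ρ r) (ρ t) ∧
      ∫ s in (ρ r)..(ρ t), a j k s (x s) ≤ M * (t - r) ∧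
      ∫ s in r..t, rescaledEnvelope a ρ j k s ≤ ∫ s in (ρ r)..(ρ t), a j k s (x s) := by
  have hsub : Icc r t ⊆ Ici 0 := fun s hs => hr.trans hs.1
  have hle : ρ r ≤ ρ t := hρ_mono hr (hr.trans hrt) hrt
  have hρr : 0 ≤ ρ r := hρ_maps hr
  have hac : AbsolutelyContinuousOnInterval ρ r t := (hρ_ac t (hr.trans hrt)).mono (by
    rw [uIcc_of_le hrt, uIcc_of_le (hr.trans hrt)]; exact Icc_subset_Icc_left hr)
  have hnn : 0 ≤ᵐ[volume.restrict (Icc (ρ r) (ρ t))] fun s => a j k s (x s) := by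
    filter_upwards [ae_restrict_mem measurableSet_Icc] with s hs
    exact ha j k s _ (hρr.trans hs.1)
  -- The change of variables is done for lower integrals because integrability is only deduced
  -- afterwards, from the resulting bound.
  have hcov : ∫⁻ s in Icc (ρ r) (ρ t), ENNReal.ofReal (a j k s (x s)) =
      ∫⁻ τ in Icc r t, ENNReal.ofReal (a j k (ρ τ) (x (ρ τ)) * deriv ρ τ) := by
    rw [lintegral_Icc_eq_lintegral_deriv_mul hrt (hρ_mono.mono hsub) hac]
    refine setLIntegral_congr_fun measurableSet_Icc fun τ hτ => ?_
    rw [ENNReal.ofReal_mul (ha j k _ _ (hρ_maps (hsub hτ))), mul_comm]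
  have hup : ∫⁻ s in Icc (ρ r) (ρ t), ENNReal.ofReal (a j k s (x s)) ≤
      ENNReal.ofReal (M * (t - r)) := by
    rw [hcov]
    calc _ ≤ ∫⁻ _ in Icc r t, ENNReal.ofReal M := by
          refine lintegral_mono_ae ?_
          filter_upwards [ae_restrict_of_ae_restrict_of_subset hsub hM] with τ hτ
          exact ENNReal.ofReal_le_ofReal (hτ _)
      _ = ENNReal.ofReal (M * (t - r)) := by
          rw [setLIntegral_const, Real.volume_Icc, ENNReal.ofReal_mul hM0]
  have hint : IntegrableOn (fun s => a j k s (x s)) (Icc (ρ r) (ρ t)) :=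
    ⟨(aemeasurable_along (ha_meas j k) hx hρr).aestronglyMeasurable,
      (hasFiniteIntegral_iff_ofReal hnn).mpr (hup.trans_lt ENNReal.ofReal_lt_top)⟩
  have hreal := ofReal_integral_eq_lintegral_ofReal hint hnn
  have hI : ∫ s in (ρ r)..(ρ t), a j k s (x s) = ∫ s in Icc (ρ r) (ρ t), a j k s (x s) := by
    rw [intervalIntegral.integral_of_le hle, integral_Icc_eq_integral_Ioc]
  rw [hI]
  refine ⟨(intervalIntegrable_iff_integrableOn_Icc_of_le hle).mpr hint, ?_, ?_⟩
  · rw [← ENNReal.ofReal_le_ofReal_iff (mul_nonneg hM0 (sub_nonneg.mpr hrt)), hreal]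
    exact hup
  · rw [intervalIntegral.integral_of_le hrt, ← integral_Icc_eq_integral_Ioc,
      ← ENNReal.ofReal_le_ofReal_iff (integral_nonneg_of_ae hnn), hreal, hcov,
      ofReal_integral_eq_lintegral_ofReal
        ((hconn.2 t).mono_set (Icc_subset_Icc_left hr))
        (ae_restrict_of_ae_restrict_of_subset hsub hconn.1)]
    rw [← setLIntegral_congr Ioc_ae_eq_Icc, ← setLIntegral_congr Ioc_ae_eq_Icc]
    refine setLIntegral_mono' measurableSet_Ioc fun τ hτ => ?_
    exact ENNReal.ofReal_le_ofReal
      (rescaledEnvelope_le ha hρ_maps hρ_mono j k (hr.trans_lt hτ.1) _)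

end Consensus

theorem mainTheorem6 {N d : ℕ}
    (a : Fin N → Fin N → ℝ → Consensus.State N d → ℝ)
    (ha_nonneg : ∀ j k t x, 0 ≤ t → 0 ≤ a j k t x)
    (ha_meas : ∀ j k, Consensus.UniversallyMeasurable
      (fun p : ℝ≥0 × Consensus.State N d => a j k (p.1 : ℝ) p.2))
    (ρ : ℝ → ℝ)
    (hρ_maps : MapsTo ρ (Ici 0) (Ici 0))
    (hρ_mono : MonotoneOn ρ (Ici 0))
    (hρ_ac : ∀ T : ℝ, 0 ≤ T → AbsolutelyContinuousOnInterval ρ 0 T)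
    (hρ_top : Tendsto ρ atTop atTop)
    (h_bdd : ∀ j k, ∃ M : ℝ, ∀ᵐ t ∂(volume.restrict (Ici (0 : ℝ))), ∀ x,
      a j k (ρ t) x * deriv ρ t ≤ M)
    (h_env : Consensus.ReachableCondition (Consensus.rescaledEnvelope a ρ) ∨
      Consensus.PairwiseCondition (Consensus.rescaledEnvelope a ρ))
    (x : ℝ → Consensus.State N d)
    (hx : Consensus.IsTrajectory a x) :
    Consensus.ConvergesToConsensus x := by
  choose M₀ hM₀ using h_bdd
  obtain ⟨M₁, hM₁⟩ := Finite.exists_le fun p : Fin N × Fin N => M₀ p.1 p.2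
  set M := max M₁ 0
  have hM0 : 0 ≤ M := le_max_right _ _
  have hM : ∀ j k, ∀ᵐ t ∂(volume.restrict (Ici (0 : ℝ))), ∀ x, a j k (ρ t) x * deriv ρ t ≤ M := by
    intro j k
    filter_upwards [hM₀ j k] with t ht y
    exact (ht y).trans ((hM₁ (j, k)).trans (le_max_left _ _))
  have hL : 0 ≤ N * M := mul_nonneg N.cast_nonneg hM0
  obtain ⟨σ, cstar, hlim, hcon⟩ := Consensus.exists_contracts hL h_env
  have hρ := Consensus.continuousOn_Ici_of_absolutelyContinuous hρ_ac
  have hb := fun j k r t (hr : 0 ≤ r) (hrt : r ≤ t) =>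
    Consensus.integral_coefficient_bounds ha_nonneg ha_meas hρ_maps hρ_mono hρ_ac (hM j k) hM0
      (hlim.connection j k) hx.continuousOn hr hrt
  have hcoord : ∀ i : Fin d, ∃ l, ∀ j, Tendsto (fun t => x t j i) atTop (𝓝 l) := by
    intro i
    have hsol : ∀ r t, 0 ≤ r → r ≤ t → Consensus.IsScalarSolution
        (fun j k s => a j k s (x s)) (fun j s => x s j i) (ρ r) (ρ t) := fun r t hr hrt =>
      hx.isScalarSolution ha_nonneg (hρ_maps hr) (hρ_mono hr (hr.trans hrt) hrt)
        (fun j k => (hb j k r t hr hrt).1) i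
    have hd := Consensus.diffuses_of_isScalarSolution hρ hsol
      (fun r t hr hrt j k => (hb j k r t hr hrt).2.1)
      (fun r t hr hrt j k => (hb j k r t hr hrt).2.2)
    have hd' := Consensus.diffuses_of_isScalarSolution hρ (fun r t hr hrt => (hsol r t hr hrt).neg)
      (fun r t hr hrt j k => (hb j k r t hr hrt).2.1)
      (fun r t hr hrt j k => (hb j k r t hr hrt).2.2)
    exact Consensus.exists_limit_of_diffuses (u := fun j s => x s j i) hρ hρ_top hd hd'
      fun η hη => hd.exists_spread_le hlim.tendsto_atTop hd' hcon hη
  choose l hl using hcoord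
  refine ⟨WithLp.toLp 2 l, fun j => ?_⟩
  exact ((PiLp.continuous_toLp 2 _).tendsto l).comp
    (f := fun t i => x t j i) (tendsto_pi_nhds.mpr fun i => hl i j)
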